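/- For a morphism of schemes $f : X \to S$, let $\mathrm{QRel}(f) \subset S$ be the set of points of the form $f(x)$ with $x \in X$ such that the residue field extension $\kappa(f(x)) \subset \kappa(x)$ is purely inseparable. A scheme $S$ is called a Poonen scheme if for every nonempty open subscheme $U \subset S$ and every dominant morphism $f : X \to U$ of finite presentation one has $\mathrm{QRel}(f) \neq \emptyset$. A commutative ring $A$ is called a Poonen ring if $\mathrm{Spec}(A)$ is a Poonen scheme. An integral domain $A$ is said to satisfy (P2) if for every nonconstant polynomial $F \in A[Y]$ there exists $b \in A$ such that $F(b) \notin A^\times$. Theorem. Let $\bar S$ be an integral scheme with function field $K$, and let $\infty$ be a closed point of $\bar S$ such that: (i) the local ring $\mathcal O := \mathcal O_{\bar S, \infty}$ is a valuation ring; (ii) $S := \bar S \setminus \{\infty\}$ is a nonempty affine scheme, with ring $A := \Gamma(S, \mathcal O_S)$; (iii) the ring $\Gamma(\bar S, \mathcal O_{\bar S})$ is a field. Then $\Gamma(\bar S, \mathcal O_{\bar S}) = A \cap \mathcal O$ as subrings of $K$, the ring $A$ satisfies (P2), $A$ is a Poonen ring, and $S$ and $\bar S$ are Poonen schemes. -/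

import Mathlib

open AlgebraicGeometry CategoryTheory

universe u

namespace PoonenScheme

/-- The set of points `x` of `X` such that the residue field extension `κ(x) / κ(f x)` is
purely inseparable ("radicielle"). -/
def qRelTilde {X S : Scheme.{u}} (f : X ⟶ S) : Set X :=
  {x | @IsPurelyInseparable (S.residueField (f x)) (X.residueField x) _ _
    (f.residueFieldMap x).hom.toAlgebra}

/-- The set of points of `S` that lift, up to a purely inseparable residue field extension,
to a point of `X`: the image of `qRelTilde f`. -/
def qRel {X S : Scheme.{u}} (f : X ⟶ S) : Set S :=
  f '' qRelTilde f

/-- A morphism of finite presentation: locally of finite presentation, quasi-compact and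
quasi-separated. -/
structure IsFinitelyPresented {X S : Scheme.{u}} (f : X ⟶ S) : Prop where
  locallyOfFinitePresentation : LocallyOfFinitePresentation f
  quasiCompact : QuasiCompact f
  quasiSeparated : QuasiSeparated f

/-- A Poonen scheme: for every nonempty open `U` of `S` and every dominant morphism `f : X ⟶ U`
of finite presentation, `qRel f` is nonempty. -/
def IsPoonenScheme (S : Scheme.{u}) : Prop :=
  ∀ U : S.Opens, (U : Set S).Nonempty →
    ∀ (X : Scheme.{u}) (f : X ⟶ U.toScheme),
      IsFinitelyPresented f → IsDominant f → (qRel f).Nonempty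

/-- A Poonen ring: a commutative ring whose spectrum is a Poonen scheme. -/
def IsPoonenRing (A : Type u) [CommRing A] : Prop :=
  IsPoonenScheme (Spec (CommRingCat.of A))

/-- Condition (P2): for every nonconstant polynomial `F` over `A` there is `b` in `A` such that
`F(b)` is not a unit. -/
def ConditionP2 (A : Type u) [CommRing A] : Prop :=
  ∀ F : Polynomial A, 0 < F.natDegree → ∃ b : A, ¬ IsUnit (F.eval b)

end PoonenScheme

/-! Let `v` be the valuation of `K` attached to `O`. A nonzero element of `A` with `v ≤ 1` lies in
the field `A ∩ O`, so its inverse does too; hence `v ≥ 1` on nonzero elements of `A`. At an argument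
of large value the leading term of `F` dominates, so `F` takes a value with `v > 1`, which has no
inverse in `A`. This is (P2), proved in `ConditionP2.of_valuationRing`.

(P2) gives the Poonen property as follows. A dominant quasi-compact `X ⟶ U` hits the generic point,
so `X` has a point over a finite extension `L` of `K`. `L` is purely inseparable over some `K(θ)`,
with `θ` a root of a monic `F` over `A`. By `ConditionP2.exists_maximal`, `F` has a root modulo a
maximal ideal `m` avoiding the denominators involved. Extending this specialisation of `θ` to a
valuation ring of `L` yields a point of `X` radicial over `A ⧸ m` (`exists_radicial_point`). One
affine open with (P2) suffices, which covers all three schemes. -/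

namespace PoonenScheme

/-! ### Commutative algebra: radicial points from (P2) -/

open Polynomial TensorProduct

/-- Over a domain satisfying (P2), a nonconstant polynomial acquires a root modulo some maximal
ideal avoiding a prescribed nonzero element. -/
theorem ConditionP2.exists_maximal {A : Type u} [CommRing A] [IsDomain A] (hA : ConditionP2 A)
    {F : A[X]} (hF : 0 < F.natDegree) {c : A} (hc : c ≠ 0) :
    ∃ m : Ideal A, m.IsMaximal ∧ c ∉ m ∧ ∃ b : A, F.eval b ∈ m := by
  -- Every value of `1 + c X H` is 1 modulo `c`, so a maximal ideal containing one cannot contain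
  -- `c`.
  have key : ∀ H : A[X], H ≠ 0 → ∃ m : Ideal A, m.IsMaximal ∧ c ∉ m ∧
      ∃ b : A, (1 + C c * (X * H)).eval b ∈ m := by
    intro H hH
    have hdeg : 0 < (1 + C c * (X * H)).natDegree := by
      have h1 : (C c * (X * H)).natDegree = H.natDegree + 1 := by
        rw [natDegree_C_mul hc, natDegree_X_mul hH]
      rw [show (1 : A[X]) = C 1 from C_1.symm, natDegree_C_add, h1]
      omega
    obtain ⟨b, hb⟩ := hA _ hdeg
    obtain ⟨m, hm, hbm⟩ := exists_max_ideal_of_mem_nonunits hb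
    refine ⟨m, hm, fun hcm => hm.ne_top ?_, b, hbm⟩
    rw [Ideal.eq_top_iff_one]
    have h2 : (1 + C c * (X * H)).eval b - c * (b * H.eval b) = 1 := by simp
    rw [← h2]
    exact m.sub_mem hbm (m.mul_mem_right _ hcm)
  by_cases h0 : F.coeff 0 = 0
  · obtain ⟨m, hm, hcm, -⟩ := key 1 one_ne_zero
    exact ⟨m, hm, hcm, 0, by rw [← coeff_zero_eq_eval_zero, h0]; exact m.zero_mem⟩
  -- Writing `F = a + X G`, one has `F(cab) = a (1 + c b G(cab))`, and the second factor has the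
  -- shape treated in `key`.
  · set a := F.coeff 0
    have hca : c * a ≠ 0 := mul_ne_zero hc h0
    have hdiv : F.divX ≠ 0 := by
      intro h
      rw [divX_eq_zero_iff] at h
      rw [h, natDegree_C] at hF
      exact hF.ne rfl
    have hcomp : (F.divX).comp (C (c * a) * X) ≠ 0 := by
      intro h
      rw [comp_eq_zero_iff] at h
      rcases h with h | ⟨-, h⟩
      · exact hdiv h
      · have := congrArg (fun p => coeff p 1) h
        simp [coeff_C] at this
        exact this.elim hc h0
    obtain ⟨m, hm, hcm, b, hb⟩ := key _ hcomp
    refine ⟨m, hm, hcm, c * a * b, ?_⟩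
    have h3 : F.eval (c * a * b) = a * (1 + C c * (X * (F.divX).comp (C (c * a) * X))).eval b := by
      conv_lhs => rw [← divX_mul_X_add F]
      simp [eval_comp]
      ring
    rw [h3]
    exact m.mul_mem_left _ hb

/-- A finite extension `L` of the fraction field of a domain `A` is, up to taking `q`-power roots,
generated by an element integral over `A` whose ideal of relations over `A` is principal. -/
theorem exists_integral_generator (A K L : Type u) [CommRing A] [IsDomain A] [Field K] [Algebra A K]
    [IsFractionRing A K] [Field L] [Algebra K L] [Algebra A L] [IsScalarTower A K L]
    [FiniteDimensional K L] :
    ∃ (θ : L) (F : A[X]), 0 < F.natDegree ∧ (∀ P : A[X], aeval θ P = 0 → F ∣ P) ∧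
      ∀ x : L, ∃ (n : ℕ) (c : A) (P : A[X]), c ≠ 0 ∧
        algebraMap A L c * x ^ ringExpChar K ^ n = aeval θ P := by
  obtain ⟨α, hα⟩ := Field.exists_primitive_element K (separableClosure K L)
  have hαi : IsIntegral K (α : L) := IsIntegral.of_finite K _
  have hinj : Function.Injective (algebraMap A K) := IsFractionRing.injective A K
  obtain ⟨G, e, he, hG⟩ : ∃ (G : A[X]) (e : A), e ≠ 0 ∧
      G.map (algebraMap A K) = e • minpoly K (α : L) := by
    obtain ⟨e, he, h⟩ := IsLocalization.integerNormalization_spec (nonZeroDivisors A)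
      (minpoly K (α : L))
    exact ⟨_, e, nonZeroDivisors.ne_zero he, h⟩
  have heK : algebraMap A K e ≠ 0 := (map_ne_zero_iff _ hinj).2 he
  have hGdeg : G.natDegree = (minpoly K (α : L)).natDegree := by
    rw [← natDegree_map_eq_of_injective hinj, hG, algebra_compatible_smul K e, smul_eq_C_mul,
      natDegree_C_mul heK]
  have hpos : 0 < G.natDegree := hGdeg ▸ minpoly.natDegree_pos hαi
  have hG0 : G ≠ 0 := fun h => by simp [h] at hpos
  have hGα : aeval (α : L) G = 0 := by
    rw [← aeval_map_algebraMap K, hG, algebra_compatible_smul K e, map_smul, minpoly.aeval,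
      smul_zero]
  set l := G.leadingCoeff with hl
  have hl0 : l ≠ 0 := leadingCoeff_ne_zero.2 hG0
  have hlK : algebraMap A K l ≠ 0 := (map_ne_zero_iff _ hinj).2 hl0
  have hinjL : Function.Injective (algebraMap A L) := by
    rw [IsScalarTower.algebraMap_eq A K L]
    exact (algebraMap K L).injective.comp hinj
  have hlL : algebraMap A L l ≠ 0 := (map_ne_zero_iff _ hinjL).2 hl0
  -- Scaling by the leading coefficient makes `θ` integral, with monic relation `F`. Division by `F`
  -- is then possible over `A`, and the remainder vanishes for degree reasons.
  set θ : L := algebraMap A L l * α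
  set F := G.integralNormalization
  have hFm : F.Monic := monic_integralNormalization hG0
  have hFdeg : F.natDegree = G.natDegree := natDegree_integralNormalization
  have hF0 : aeval θ F = 0 :=
    integralNormalization_aeval_eq_zero hGα (fun x hx => hinjL (by simpa using hx))
  refine ⟨θ, F, hFdeg ▸ hpos, fun P hP => ?_, fun x => ?_⟩
  · rw [← modByMonic_eq_zero_iff_dvd hFm]
    set r := P %ₘ F with hr
    have hrθ : aeval θ r = 0 := by
      have := congrArg (aeval θ) (modByMonic_add_div P F)
      rwa [map_add, map_mul, hF0, zero_mul, add_zero, hP] at this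
    have hdvd : minpoly K (α : L) ∣ (r.map (algebraMap A K)).comp (C (algebraMap A K l) * X) := by
      apply minpoly.dvd
      rw [aeval_comp, map_mul, aeval_C, aeval_X, ← IsScalarTower.algebraMap_apply,
        aeval_map_algebraMap]
      exact hrθ
    have hlt : r.natDegree < F.natDegree :=
      natDegree_modByMonic_lt P hFm (fun h => by simp [h] at hFdeg; omega)
    have hz := eq_zero_of_dvd_of_natDegree_lt hdvd (by
      refine lt_of_le_of_lt natDegree_comp_le ?_
      rw [natDegree_C_mul_X _ hlK, mul_one, natDegree_map_eq_of_injective hinj]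
      omega)
    rcases comp_eq_zero_iff.1 hz with h | ⟨-, h⟩
    · exact (Polynomial.map_eq_zero_iff hinj).1 h
    · have := congrArg (fun p => coeff p 1) h
      simp [coeff_C] at this
      exact absurd this hl0
  · have : ExpChar K (ringExpChar K) := inferInstance
    have : ExpChar (separableClosure K L) (ringExpChar K) :=
      expChar_of_injective_algebraMap (algebraMap K _).injective _
    obtain ⟨n, y, hy⟩ := IsPurelyInseparable.pow_mem (separableClosure K L) (ringExpChar K) x
    have hyα : y ∈ IntermediateField.adjoin K {α} := hα ▸ IntermediateField.mem_top
    rw [← IntermediateField.mem_toSubalgebra,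
      IntermediateField.adjoin_simple_toSubalgebra_of_isAlgebraic (Algebra.IsAlgebraic.isAlgebraic _),
      Algebra.adjoin_singleton_eq_range_aeval] at hyα
    obtain ⟨P, hP⟩ := hyα
    obtain ⟨c, hc, hQ⟩ := IsLocalization.integerNormalization_spec (nonZeroDivisors A)
      (P.comp (C (algebraMap A K l)⁻¹ * X))
    refine ⟨n, c, IsLocalization.integerNormalization (nonZeroDivisors A)
      (P.comp (C (algebraMap A K l)⁻¹ * X)), nonZeroDivisors.ne_zero hc, ?_⟩
    rw [← aeval_map_algebraMap K, hQ, algebra_compatible_smul K c, map_smul, aeval_comp, map_mul,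
      aeval_C, aeval_X, map_inv₀, ← IsScalarTower.algebraMap_apply, ← mul_assoc,
      inv_mul_cancel₀ hlL, one_mul, ← hy, ← hP, Algebra.smul_def, ← IsScalarTower.algebraMap_apply]
    congr 1
    exact (aeval_algebraMap_apply L α P).symm

/-- A finite type algebra over a domain, nontrivial over the generic point, has a homomorphism to a
finite extension of the fraction field. -/
theorem exists_algHom_finiteDimensional (A B K : Type u) [CommRing A] [IsDomain A] [Field K]
    [Algebra A K] [IsFractionRing A K] [CommRing B] [Algebra A B] [Algebra.FiniteType A B]
    (Q : Ideal B) [Q.IsPrime] (hQ : Q.comap (algebraMap A B) = ⊥) :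
    ∃ (L : Type u) (_ : Field L) (_ : Algebra K L) (_ : Algebra A L), IsScalarTower A K L ∧
      FiniteDimensional K L ∧ Nonempty (B →ₐ[A] L) := by
  let Ω := FractionRing (B ⧸ Q)
  have hinj : Function.Injective (algebraMap A Ω) := by
    rw [IsScalarTower.algebraMap_eq A (B ⧸ Q) Ω, RingHom.coe_comp]
    refine (IsFractionRing.injective (B ⧸ Q) Ω).comp ?_
    rw [injective_iff_map_eq_zero]
    intro a ha
    rw [IsScalarTower.algebraMap_apply A B (B ⧸ Q), Ideal.Quotient.algebraMap_eq,
      Ideal.Quotient.eq_zero_iff_mem, ← Ideal.mem_comap, hQ] at ha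
    exact ha
  let i : K →ₐ[A] Ω := IsFractionRing.liftAlgHom (g := Algebra.ofId A Ω) hinj
  let j : B →ₐ[A] Ω := IsScalarTower.toAlgHom A B Ω
  -- The generic fibre is nonzero because it maps to `Ω`; the Nullstellensatz makes its residue
  -- fields finite over `K`.
  have : Nontrivial (K ⊗[A] B) := (Algebra.TensorProduct.productMap i j).toRingHom.domain_nontrivial
  obtain ⟨M, hM⟩ := Ideal.exists_maximal (K ⊗[A] B)
  let : Field ((K ⊗[A] B) ⧸ M) := Ideal.Quotient.field M
  refine ⟨(K ⊗[A] B) ⧸ M, inferInstance, inferInstance, inferInstance, inferInstance, ?_, ?_⟩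
  · exact finite_of_finite_type_of_isJacobsonRing _ _
  · exact ⟨(Ideal.Quotient.mkₐ A M).comp Algebra.TensorProduct.includeRight⟩

/-- A power of the exponential characteristic of a field containing `A` is also a power of that of
any field to which `A` maps. -/
theorem exists_ringExpChar_pow_eq {A K k : Type*} [CommRing A] [Field K] [Field k] (f : A →+* K)
    (hf : Function.Injective f) (g : A →+* k) (n : ℕ) :
    ∃ n', ringExpChar K ^ n = ringExpChar k ^ n' := by
  obtain h | ⟨p, hp, h⟩ : ringExpChar K = 1 ∨ ∃ p, p.Prime ∧ CharP K p := by
    rcases CharP.exists K with ⟨p, hp⟩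
    rcases CharP.char_is_prime_or_zero K p with h | rfl
    · exact Or.inr ⟨p, h, hp⟩
    · have := CharP.charP_to_charZero K
      exact Or.inl (ringExpChar.eq_one K)
  -- If `K` has characteristic zero the power is 1, whatever the characteristic of `k`.
  · exact ⟨0, by simp [h]⟩
  · have := Fact.mk hp
    have hA : CharP A p := (RingHom.charP_iff f hf p).2 h
    have hk : CharP k p := by
      refine ringChar.of_eq (CharP.ringChar_of_prime_eq_zero hp ?_)
      rw [← map_natCast g, CharP.cast_eq_zero, map_zero]
    have := ringExpChar.eq K p
    have := ringExpChar.eq k p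
    exact ⟨n, by simp_all⟩

/-- A finite type algebra `B` over a domain `A` satisfying (P2), nontrivial over the generic point, has
a homomorphism to a field `E` which is purely inseparable over the residue field of `A`. -/
theorem exists_radicial_point {A B : Type u} [CommRing A] [IsDomain A] (hA : ConditionP2 A)
    [CommRing B] [Algebra A B] [Algebra.FiniteType A B]
    (Q : Ideal B) [Q.IsPrime] (hQ : Q.comap (algebraMap A B) = ⊥) :
    ∃ (E : Type u) (_ : Field E) (ψ : B →+* E),
      ∀ x : E, ∃ (n : ℕ) (a : A), x ^ ringExpChar E ^ n = ψ (algebraMap A B a) := by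
  let K := FractionRing A
  obtain ⟨L, _, _, _, _, _, ⟨g⟩⟩ := exists_algHom_finiteDimensional A B K Q hQ
  obtain ⟨θ, F, hF, hker, hgen⟩ := exists_integral_generator A K L
  have hinjL : Function.Injective (algebraMap A L) := by
    rw [IsScalarTower.algebraMap_eq A K L]
    exact (algebraMap K L).injective.comp (IsFractionRing.injective A K)
  obtain ⟨s, hs⟩ := Algebra.FiniteType.out (R := A) (A := B)
  choose n c P hc hP using hgen
  have hc0 : ∏ b ∈ s, c (g b) ≠ 0 := Finset.prod_ne_zero_iff.2 fun b _ => hc _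
  obtain ⟨m, hm, hcm, b₀, hb₀⟩ := hA.exists_maximal hF hc0
  let : Field (A ⧸ m) := Ideal.Quotient.field m
  -- the ideal of `A[θ]` generated by `m` and `θ - b₀`
  let φ : A[X] →+* A ⧸ m := (Ideal.Quotient.mk m).comp (evalRingHom b₀)
  let R : Subring L := (aeval θ : A[X] →ₐ[A] L).toRingHom.range
  let π : A[X] →+* R := (aeval θ : A[X] →ₐ[A] L).toRingHom.rangeRestrict
  have hπ : Function.Surjective π := RingHom.rangeRestrict_surjective _
  have hπφ : RingHom.ker π ≤ RingHom.ker φ := by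
    intro p hp
    have hp' : aeval θ p = 0 := congrArg Subtype.val hp
    obtain ⟨r, rfl⟩ := hker p hp'
    have : F.eval b₀ * r.eval b₀ ∈ m := m.mul_mem_right _ hb₀
    simpa [φ, RingHom.mem_ker, Ideal.Quotient.eq_zero_iff_mem, ← map_mul] using this
  -- The specialisation `θ ↦ b₀` of `A[θ]`; it is well defined since all relations of `θ` are
  -- multiples of `F`.
  let χ : R →+* A ⧸ m := RingHom.liftOfSurjective π hπ ⟨φ, hπφ⟩
  have hχ : ∀ p, χ (π p) = φ p := fun p => by
    exact RingHom.liftOfRightInverse_comp_apply _ _ _ ⟨φ, hπφ⟩ p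
  obtain ⟨V, hRV, hV⟩ := Ideal.image_subset_nonunits_valuationSubring (RingHom.ker χ)
    (RingHom.ker_ne_top χ)
  have hAR : ∀ a : A, algebraMap A L a ∈ R := fun a => ⟨C a, by simp⟩
  let ιA : A →+* V := (algebraMap A L).codRestrict V.toSubring (fun a => hRV (hAR a))
  let κ := IsLocalRing.ResidueField V
  have hres : ∀ p : A[X], φ p = 0 → ∀ v : V, (v : L) = aeval θ p →
      IsLocalRing.residue V v = 0 := by
    intro p hp v hv
    have h1 : ((π p : R) : L) ∈ V.nonunits :=
      hV ⟨π p, by rw [SetLike.mem_coe, RingHom.mem_ker, hχ, hp], rfl⟩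
    rw [IsLocalRing.residue_eq_zero_iff, V.valuation_lt_one_iff, hv, ← V.mem_nonunits_iff]
    exact h1
  let ρ : A ⧸ m →+* κ := Ideal.Quotient.lift m ((IsLocalRing.residue V).comp ιA) fun a ha =>
    hres (C a) (by simpa [φ, Ideal.Quotient.eq_zero_iff_mem] using ha) _ (by simp [ιA])
  let _ : Algebra (A ⧸ m) κ := ρ.toAlgebra
  have hκ : ∀ p : A[X], ∀ v : V, (v : L) = aeval θ p → IsLocalRing.residue V v = ρ (φ p) := by
    intro p v hv
    rw [← sub_eq_zero]
    change IsLocalRing.residue V v - IsLocalRing.residue V (ιA (p.eval b₀)) = 0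
    rw [← map_sub]
    exact hres (p - C (p.eval b₀)) (by simp [φ]) _ (by simp [ιA, hv])
  let E := perfectClosure (A ⧸ m) κ
  -- In `c * g(b) ^ N = P(θ)` the factor `c` is a unit of `V`, as `m` avoids it. So `g(b)` lies in
  -- `V`, and the `N`-th power of its residue comes from `A ⧸ m`.
  have hgs : ∀ b ∈ s, ∃ v : V, (v : L) = g b ∧ IsLocalRing.residue V v ∈ E := by
    intro b hb
    have hcb : Ideal.Quotient.mk m (c (g b)) ≠ 0 := fun h =>
      hcm (Ideal.mem_of_dvd m (Finset.dvd_prod_of_mem _ hb) (Ideal.Quotient.eq_zero_iff_mem.1 h))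
    have hunit : IsUnit (ιA (c (g b))) := by
      by_contra h
      have h1 : IsLocalRing.residue V (ιA (c (g b))) = 0 := (IsLocalRing.residue_eq_zero_iff _).2 h
      exact hcb ((map_eq_zero ρ).1 h1)
    have hN : ringExpChar K ^ n (g b) ≠ 0 := pow_ne_zero _ (expChar_ne_zero K _)
    have hval : V.valuation (g b) ≤ 1 := by
      rw [← pow_le_one_iff hN, ← map_pow]
      have h1 := congrArg V.valuation (hP (g b))
      rw [map_mul] at h1
      have h2 : V.valuation (algebraMap A L (c (g b))) = 1 := (V.valuation_eq_one_iff _).1 hunit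
      rw [h2, one_mul] at h1
      rw [h1, V.valuation_le_one_iff]
      exact hRV ⟨P (g b), rfl⟩
    refine ⟨⟨g b, (V.valuation_le_one_iff _).1 hval⟩, rfl, ?_⟩
    obtain ⟨n', hn'⟩ := exists_ringExpChar_pow_eq (algebraMap A K) (IsFractionRing.injective A K)
      (Ideal.Quotient.mk m) (n (g b))
    rw [mem_perfectClosure_iff]
    refine ⟨n', φ (P (g b)) / Ideal.Quotient.mk m (c (g b)), ?_⟩
    have h3 := hκ (P (g b)) (ιA (c (g b)) * ⟨g b, (V.valuation_le_one_iff _).1 hval⟩ ^ _)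
      (hP (g b))
    rw [map_mul, map_pow, mul_comm] at h3
    rw [← hn', map_div₀]
    exact (eq_div_of_mul_eq ((_root_.map_ne_zero ρ).2 hcb) h3).symm
  have hgB : ∀ b, ∃ v : V, (v : L) = g b ∧ IsLocalRing.residue V v ∈ E := by
    intro b
    have hb : b ∈ Algebra.adjoin A (s : Set B) := hs ▸ Algebra.mem_top
    induction hb using Algebra.adjoin_induction with
    | mem b hb => exact hgs b hb
    | algebraMap a =>
      exact ⟨ιA a, (g.commutes a).symm, E.algebraMap_mem (Ideal.Quotient.mk m a)⟩
    | add x y _ _ hx hy =>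
      obtain ⟨v, hv, hvE⟩ := hx
      obtain ⟨w, hw, hwE⟩ := hy
      exact ⟨v + w, by simp [hv, hw], by rw [map_add]; exact E.add_mem hvE hwE⟩
    | mul x y _ _ hx hy =>
      obtain ⟨v, hv, hvE⟩ := hx
      obtain ⟨w, hw, hwE⟩ := hy
      exact ⟨v * w, by simp [hv, hw], by rw [map_mul]; exact E.mul_mem hvE hwE⟩
  let gV : B →+* V := g.toRingHom.codRestrict V.toSubring fun b => by
    obtain ⟨v, hv, -⟩ := hgB b
    exact hv ▸ v.2
  let ψ : B →+* E := ((IsLocalRing.residue V).comp gV).codRestrict E.toSubring fun b => by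
    obtain ⟨v, hv, hvE⟩ := hgB b
    obtain rfl : v = gV b := Subtype.ext hv
    exact hvE
  have hexp : ringExpChar E = ringExpChar (A ⧸ m) :=
    ringExpChar.eq_iff.2 (expChar_of_injective_algebraMap (algebraMap (A ⧸ m) E).injective (ringExpChar (A ⧸ m)))
  refine ⟨E, inferInstance, ψ, fun x => ?_⟩
  obtain ⟨n', y, hy⟩ := mem_perfectClosure_iff.1 x.2
  obtain ⟨a, rfl⟩ := Ideal.Quotient.mk_surjective y
  refine ⟨n', a, Subtype.ext ?_⟩
  rw [hexp]
  refine hy.symm.trans (congrArg (IsLocalRing.residue V) (Subtype.ext ?_))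
  exact (g.commutes a).symm

end PoonenScheme

/-! ### From rings to schemes: generic points and residue fields -/

namespace PoonenScheme

open Limits

theorem exists_isOpenImmersion_Spec (X : Scheme.{u}) (x : X) :
    ∃ (R : CommRingCat.{u}) (w : Spec R ⟶ X), IsOpenImmersion w ∧ ∃ y, w y = x :=
  ⟨_, X.affineCover.f (X.affineCover.idx x),
    inferInstanceAs (IsOpenImmersion (X.affineCover.f _)), X.affineCover.covers x⟩

/-- A dominant quasi-compact morphism to an integral scheme hits the generic point. -/
theorem genericPoint_mem_range {X Y : Scheme.{u}} [AlgebraicGeometry.IsIntegral Y] (f : X ⟶ Y)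
    [QuasiCompact f] [IsDominant f] : genericPoint Y ∈ Set.range f := by
  wlog hY : ∃ R, Y = Spec R generalizing X Y with H
  · obtain ⟨R, i, _, y, -⟩ := exists_isOpenImmersion_Spec Y (genericPoint Y)
    have : Nonempty (Spec R) := ⟨y⟩
    have : AlgebraicGeometry.IsIntegral (Spec R) := isIntegral_of_isOpenImmersion i
    have : IsDominant (pullback.snd f i) :=
      IsZariskiLocalAtTarget.of_isPullback (P := @IsDominant) (.of_hasPullback _ _) ‹_›
    obtain ⟨x, hx⟩ := H (pullback.snd f i) ⟨_, rfl⟩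
    refine ⟨pullback.fst f i x, ?_⟩
    rw [← Scheme.Hom.comp_apply, pullback.condition, Scheme.Hom.comp_apply, hx,
      genericPoint_eq_of_isOpenImmersion]
  obtain ⟨R, rfl⟩ := hY
  obtain ⟨T, g, hg⟩ := compactSpace_iff_exists.mp (QuasiCompact.compactSpace_of_compactSpace f)
  obtain ⟨φ, hφ⟩ := Spec.map_surjective (g ≫ f)
  have hdense : DenseRange (g ≫ f) := by
    rw [Scheme.Hom.comp_base, TopCat.coe_comp]
    exact f.denseRange.comp hg.denseRange f.continuous
  have : IsDomain R := (affine_isIntegral_iff R).1 inferInstance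
  rw [← hφ] at hdense
  have h1 := (PrimeSpectrum.denseRange_comap_iff_minimalPrimes φ.hom).1 hdense ⊥
    (by rw [IsDomain.minimalPrimes_eq_singleton_bot]; rfl)
  obtain ⟨t, ht⟩ := h1
  refine ⟨g t, (Scheme.Hom.comp_apply g f t).symm.trans ?_⟩
  rw [← hφ, genericPoint_eq_bot_of_affine]
  exact ht

/-- A homomorphism of fields `φ : F →+* E` is radicial if each element of `E` has a `q`-power in the
image of `F`, where `q` is a power of the exponential characteristic. -/
def IsRadicial {F E : Type*} [Field F] [Field E] (φ : F →+* E) : Prop :=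
  ∀ x : E, ∃ n : ℕ, x ^ ringExpChar E ^ n ∈ φ.range

theorem IsRadicial.isPurelyInseparable {F E : Type*} [Field F] [Field E] {φ : F →+* E}
    (h : IsRadicial φ) : @IsPurelyInseparable F E _ _ φ.toAlgebra := by
  let _ := φ.toAlgebra
  have : ExpChar F (ringExpChar E) := (RingHom.expChar_iff φ φ.injective _).2 inferInstance
  exact (isPurelyInseparable_iff_pow_mem F (ringExpChar E)).2 h

theorem ringExpChar_eq_of_ringHom {F E : Type*} [Field F] [Field E] (φ : F →+* E) :
    ringExpChar F = ringExpChar E :=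
  ringExpChar.eq_iff.2 ((RingHom.expChar_iff φ φ.injective _).2 inferInstance)

/-- Used for `Spec E ⟶ X ⟶ U ⟶ S`: it isolates the residue extension of the middle map. -/
theorem IsRadicial.of_comp_comp {F E K L : Type*} [Field F] [Field E] [Field K] [Field L]
    {φ : F →+* E} {χ : E →+* K} {ψ : K →+* L} (h : IsRadicial (ψ.comp (χ.comp φ))) :
    IsRadicial χ := by
  intro x
  obtain ⟨n, a, ha⟩ := h (ψ x)
  rw [← ringExpChar_eq_of_ringHom ψ, ← map_pow] at ha
  exact ⟨n, φ a, ψ.injective ha⟩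

theorem IsRadicial.comp_surjective {F E K : Type*} [Field F] [Field E] [Field K]
    {φ : F →+* E} {χ : E →+* K} (h : IsRadicial χ) (hφ : Function.Surjective φ) :
    IsRadicial (χ.comp φ) := by
  intro x
  obtain ⟨n, a, ha⟩ := h x
  obtain ⟨b, rfl⟩ := hφ a
  exact ⟨n, b, ha⟩

/-- The residue extension of the point `Spec E ⟶ Spec A`. -/
theorem isRadicial_residueFieldMap_Spec {A E : Type u} [CommRing A] [Field E] (φ : A →+* E)
    (h : ∀ x : E, ∃ (n : ℕ) (a : A), x ^ ringExpChar E ^ n = φ a)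
    (p : Spec (CommRingCat.of E)) :
    IsRadicial ((Spec.map (CommRingCat.ofHom φ)).residueFieldMap p).hom := by
  set f := Spec.map (CommRingCat.ofHom φ)
  let ε : E →+* (Spec (CommRingCat.of E)).residueField p :=
    ((Scheme.ΓSpecIso (.of E)).inv ≫ (Spec (.of E)).Γevaluation p).hom
  let α : A →+* (Spec (CommRingCat.of A)).residueField (f p) :=
    ((Scheme.ΓSpecIso (.of A)).inv ≫ (Spec (.of A)).Γevaluation (f p)).hom
  have hcomm : ∀ a, (f.residueFieldMap p).hom (α a) = ε (φ a) := by
    intro a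
    have h1 := Scheme.Γevaluation_naturality_apply f p ((Scheme.ΓSpecIso (.of A)).inv a)
    have h2 := ConcreteCategory.congr_hom
      (Scheme.ΓSpecIso_inv_naturality (CommRingCat.ofHom φ)) a
    exact h1.trans (congrArg ((Spec (CommRingCat.of E)).Γevaluation p) h2.symm)
  have hsurj : Function.Surjective ε := by
    have hmax : p.asIdeal.IsMaximal := by
      rw [(Ideal.eq_bot_or_top p.asIdeal).resolve_right p.isPrime.ne_top]
      exact Ideal.bot_isMaximal
    intro x
    obtain ⟨y, hy⟩ := Ideal.algebraMap_residueField_surjective p.asIdeal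
      ((Scheme.Spec.residueFieldIso (.of E) p).hom x)
    refine ⟨y, ?_⟩
    have h1 := ConcreteCategory.congr_hom (Scheme.Spec.algebraMap_residueFieldIso_inv (.of E) p) y
    refine h1.symm.trans ?_
    exact (congrArg (Scheme.Spec.residueFieldIso (.of E) p).inv hy).trans
      (Iso.hom_inv_id_apply (Scheme.Spec.residueFieldIso (.of E) p) x)
  intro x
  obtain ⟨y, rfl⟩ := hsurj x
  obtain ⟨n, a, ha⟩ := h y
  exact ⟨n, α a, by rw [hcomm, ← ha, ← ringExpChar_eq_of_ringHom ε, map_pow]⟩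

/-- An integral scheme containing as a nonempty open subscheme the spectrum of a domain satisfying
(P2) is a Poonen scheme. -/
theorem IsPoonenScheme.of_conditionP2 {A : Type u} [CommRing A] [IsDomain A] (hA : ConditionP2 A)
    {S : Scheme.{u}} [AlgebraicGeometry.IsIntegral S] (j : Spec (CommRingCat.of A) ⟶ S)
    [IsOpenImmersion j] : IsPoonenScheme S := by
  intro U hU X f hf hdom
  obtain ⟨hfp, hqc, -⟩ := hf
  have : LocallyOfFiniteType f := inferInstance
  have : Nonempty U := hU.to_subtype
  obtain ⟨x, hx⟩ := genericPoint_mem_range f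
  have hx' : (f ≫ U.ι) x = j (genericPoint _) := by
    rw [Scheme.Hom.comp_apply, hx, genericPoint_eq_of_isOpenImmersion,
      genericPoint_eq_of_isOpenImmersion]
  -- An affine chart around a point of the pullback over the generic point supplies the algebra `B`
  -- and the prime `Q`.
  obtain ⟨z, hz, hz'⟩ := Scheme.Pullback.exists_preimage_pullback _ _ hx'
  obtain ⟨R, w, _, y, hy⟩ := exists_isOpenImmersion_Spec _ z
  obtain ⟨φ, hφ⟩ := Spec.map_surjective (w ≫ pullback.snd (f ≫ U.ι) j)
  have hft : φ.hom.FiniteType := by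
    rw [← HasRingHomProperty.Spec_iff (P := @LocallyOfFiniteType), hφ]
    infer_instance
  algebraize [φ.hom]
  have hy0 : (w ≫ pullback.snd (f ≫ U.ι) j) y = genericPoint (Spec (CommRingCat.of A)) := by
    rw [Scheme.Hom.comp_apply, hy, hz']
  rw [← hφ, genericPoint_eq_bot_of_affine] at hy0
  have := y.isPrime
  obtain ⟨E, _, ψ, hψ⟩ := exists_radicial_point hA y.asIdeal (congrArg PrimeSpectrum.asIdeal hy0)
  let h : Spec (CommRingCat.of E) ⟶ X := Spec.map (CommRingCat.ofHom ψ) ≫ w ≫ pullback.fst _ _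
  have heq : h ≫ f ≫ U.ι = Spec.map (CommRingCat.ofHom (ψ.comp φ.hom)) ≫ j := by
    simp only [h, Category.assoc]
    rw [pullback.condition, reassoc_of% hφ.symm, ← Spec.map_comp_assoc]
    rfl
  let p : Spec (CommRingCat.of E) := (⊥ : PrimeSpectrum E)
  have h1 : IsRadicial ((h ≫ f ≫ U.ι).residueFieldMap p).hom := by
    rw [heq, Scheme.residueFieldMap_comp]
    refine IsRadicial.comp_surjective (φ := (j.residueFieldMap _).hom)
      (isRadicial_residueFieldMap_Spec _ hψ p) ?_
    exact (ConcreteCategory.bijective_of_isIso (j.residueFieldMap _)).2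
  rw [Scheme.residueFieldMap_comp, Scheme.residueFieldMap_comp] at h1
  exact ⟨_, h p, IsRadicial.isPurelyInseparable (IsRadicial.of_comp_comp h1), rfl⟩

end PoonenScheme

/-! ### (P2) from a valuation, and gluing of rational functions -/

namespace PoonenScheme

open Polynomial

/-- Let `A` be a domain with fraction field `K`, and let `O` be a nontrivial valuation ring of `K`.
If the nonzero elements of `A ∩ O` are invertible in `A ∩ O`, then `A` satisfies (P2). -/
theorem ConditionP2.of_valuationRing {A O K : Type*} [CommRing A] [Field K]
    [Algebra A K] [IsFractionRing A K] [CommRing O] [IsDomain O] [ValuationRing O] [Algebra O K]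
    [IsFractionRing O K] (hO : ¬ Function.Surjective (algebraMap O K))
    (hk : ∀ a : A, a ≠ 0 → algebraMap A K a ∈ (algebraMap O K).range →
      ∃ b, a * b = 1 ∧ algebraMap A K b ∈ (algebraMap O K).range) : ConditionP2 A := by
  set v := ValuationRing.valuation O K
  have hv : ∀ x : K, v x ≤ 1 ↔ x ∈ (algebraMap O K).range := fun x =>
    ValuationRing.mem_integer_iff O K x
  have hinj : Function.Injective (algebraMap A K) := IsFractionRing.injective A K
  have hpos : ∀ a : A, a ≠ 0 → 1 ≤ v (algebraMap A K a) := by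
    intro a ha
    by_contra! hlt
    obtain ⟨b, hab, hb⟩ := hk a ha ((hv _).1 hlt.le)
    have h1 : v (algebraMap A K a) * v (algebraMap A K b) = 1 := by
      rw [← map_mul, ← map_mul, hab, map_one, map_one]
    exact (mul_lt_one_of_lt_of_le hlt ((hv _).2 hb)).ne h1
  have : IsDomain A := hinj.isDomain _
  -- Otherwise `v = 1` on all nonzero elements of `A`, hence on all nonzero fractions, and `O` would
  -- be `K`.
  obtain ⟨t₀, ht₀⟩ : ∃ t : A, 1 < v (algebraMap A K t) := by
    by_contra! hle
    refine hO fun x => ?_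
    obtain ⟨a, b, hb, rfl⟩ := IsFractionRing.div_surjective (A := A) x
    rw [← RingHom.mem_range, ← hv, map_div₀]
    exact div_le_one_of_le₀ ((hle a).trans (hpos b (nonZeroDivisors.ne_zero hb))) zero_le
  intro F hF
  have hprod : ∀ s : Finset ℕ, s ⊆ F.support → ∀ i ∈ s,
      v (algebraMap A K (F.coeff i)) ≤ v (algebraMap A K (∏ i ∈ s, F.coeff i)) := by
    intro s hs i hi
    rw [← Finset.mul_prod_erase s _ hi, map_mul, map_mul]
    refine le_mul_of_one_le_right' (hpos _ (Finset.prod_ne_zero_iff.2 fun j hj => ?_))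
    exact mem_support_iff.1 (hs (Finset.mem_of_mem_erase hj))
  obtain ⟨t, hcoeff⟩ : ∃ t : A, ∀ i, v (algebraMap A K (F.coeff i)) < v (algebraMap A K t) := by
    -- Each factor has value at least 1, so the product bounds every coefficient; `t₀` makes the
    -- bound strict.
    refine ⟨t₀ * ∏ i ∈ F.support, F.coeff i, fun i => ?_⟩
    have hp : 1 ≤ v (algebraMap A K (∏ i ∈ F.support, F.coeff i)) :=
      hpos _ (Finset.prod_ne_zero_iff.2 fun j hj => mem_support_iff.1 hj)
    have h1 : v (algebraMap A K (F.coeff i)) ≤ v (algebraMap A K (∏ i ∈ F.support, F.coeff i)) := by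
      by_cases hi : i ∈ F.support
      · exact hprod _ subset_rfl i hi
      · rw [notMem_support_iff.1 hi, map_zero, map_zero]
        exact zero_le
    rw [map_mul, map_mul]
    exact h1.trans_lt (lt_mul_of_one_lt_left (zero_lt_one.trans_le hp) ht₀)
  have hF0 : F.leadingCoeff ≠ 0 := leadingCoeff_ne_zero.2 fun h => by simp [h] at hF
  have ht : 1 < v (algebraMap A K t) := (hpos _ hF0).trans_lt (hcoeff _)
  have ht0 : 0 < v (algebraMap A K t) := zero_lt_one.trans ht
  have hlead : v (algebraMap A K t) ^ F.natDegree ≤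
      v (algebraMap A K (F.leadingCoeff * t ^ F.natDegree)) := by
    rw [map_mul, map_mul, map_pow, map_pow]
    exact le_mul_of_one_le_left' (hpos _ hF0)
  have hsum : v (algebraMap A K (∑ i ∈ Finset.range F.natDegree, F.coeff i * t ^ i)) <
      v (algebraMap A K (F.leadingCoeff * t ^ F.natDegree)) := by
    refine lt_of_lt_of_le ?_ hlead
    rw [map_sum]
    refine v.map_sum_lt (pow_ne_zero _ ht0.ne') fun i hi => ?_
    rw [map_mul, map_mul, map_pow, map_pow]
    calc v (algebraMap A K (F.coeff i)) * v (algebraMap A K t) ^ i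
        < v (algebraMap A K t) * v (algebraMap A K t) ^ i :=
          mul_lt_mul_of_pos_right (hcoeff i) (pow_pos ht0 i)
      _ = v (algebraMap A K t) ^ (i + 1) := (pow_succ' _ _).symm
      _ ≤ v (algebraMap A K t) ^ F.natDegree :=
          pow_le_pow_right₀ ht.le (Finset.mem_range.1 hi)
  have heval : v (algebraMap A K (F.eval t)) =
      v (algebraMap A K (F.leadingCoeff * t ^ F.natDegree)) := by
    rw [eval_eq_sum_range, Finset.sum_range_succ, map_add]
    exact v.map_add_eq_of_lt_right hsum
  refine ⟨t, fun hu => ?_⟩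
  obtain ⟨b, hb⟩ := hu.exists_right_inv
  have hb0 : b ≠ 0 := right_ne_zero_of_mul_eq_one hb
  have h1 : v (algebraMap A K (F.eval t)) * v (algebraMap A K b) = 1 := by
    rw [← map_mul, ← map_mul, hb, map_one, map_one]
  have h2 : 1 < v (algebraMap A K (F.eval t)) := by
    rw [heval]
    exact (one_lt_pow₀ ht hF.ne').trans_le hlead
  exact (one_lt_mul_of_lt_of_le' h2 (hpos b hb0)).ne' h1

/-- A point of an integral scheme whose local ring is the whole function field is generic. -/
theorem eq_genericPoint_of_surjective {X : Scheme.{u}} [AlgebraicGeometry.IsIntegral X] (x : X)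
    (h : Function.Surjective (algebraMap (X.presheaf.stalk x) X.functionField)) :
    x = genericPoint X := by
  have hfield : IsField (X.presheaf.stalk x) := IsFractionRing.surjective_iff_isField.1 h
  let _ := hfield.toField
  have h1 : x ∈ Set.range (X.fromSpecStalk x) := by
    rw [Scheme.range_fromSpecStalk]
    exact specializes_rfl
  have h2 : genericPoint X ∈ Set.range (X.fromSpecStalk x) := by
    rw [Scheme.range_fromSpecStalk]
    exact (genericPoint_spec X).specializes trivial
  obtain ⟨p, hp⟩ := h1
  obtain ⟨q, hq⟩ := h2
  -- The spectrum of the stalk parametrises the generizations of `x`, among them the generic point;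
  -- for a field there is only one.
  have : Subsingleton (Spec (X.presheaf.stalk x)) :=
    inferInstanceAs (Subsingleton (PrimeSpectrum (X.presheaf.stalk x)))
  rw [← hp, ← hq, Subsingleton.elim p q]

/-- A rational function is regular if and only if it is regular at a point `x` and on the
complement of `x`, assumed open. -/
theorem range_germ_top {X : Scheme.{u}} [AlgebraicGeometry.IsIntegral X] (x : X) (S : X.Opens)
    [Nonempty S] (hS : (S : Set X) = {x}ᶜ) :
    (X.presheaf.germ ⊤ (genericPoint X) trivial).hom.range =
      (X.germToFunctionField S).hom.range ⊓
        (algebraMap (X.presheaf.stalk x) X.functionField).range := by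
  have hη : genericPoint X ∈ S := ((genericPoint_spec X).mem_open_set_iff S.isOpen).2
    (by simpa using ‹Nonempty S›)
  apply le_antisymm
  · rintro _ ⟨s, rfl⟩
    refine ⟨⟨X.presheaf.map (homOfLE le_top).op s, ?_⟩, ⟨X.presheaf.germ ⊤ x trivial s, ?_⟩⟩
    · exact X.presheaf.germ_res_apply (homOfLE le_top) (genericPoint X) hη s
    · have : Nonempty (⊤ : X.Opens) := ⟨⟨x, trivial⟩⟩
      exact Scheme.algebraMap_germ_eq_germToFunctionField X (U := ⊤) (x := x) trivial s
  · rintro z ⟨⟨a, ha⟩, ⟨o, ho⟩⟩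
    obtain ⟨V, hV, s, rfl⟩ := X.presheaf.exists_germ_eq o
    have : Nonempty V := ⟨⟨x, hV⟩⟩
    rw [Scheme.algebraMap_germ_eq_germToFunctionField] at ho
    have hηV : genericPoint X ∈ V := ((genericPoint_spec X).mem_open_set_iff V.isOpen).2
      (by simpa using ‹Nonempty V›)
    have hcov : ⊤ ≤ S ⊔ V := by
      intro y _
      by_cases hy : y = x
      · exact Or.inr (hy ▸ hV)
      · exact Or.inl (hS.ge hy)
    -- On an integral scheme sections are determined by their generic germ, so the two sections
    -- glue.
    have hagree : X.presheaf.map (homOfLE (inf_le_left : S ⊓ V ≤ S)).op a =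
        X.presheaf.map (homOfLE (inf_le_right : S ⊓ V ≤ V)).op s := by
      have hηSV : genericPoint X ∈ S ⊓ V := ⟨hη, hηV⟩
      apply germ_injective_of_isIntegral X (genericPoint X) hηSV
      exact (X.presheaf.germ_res_apply (homOfLE inf_le_left) _ hηSV a).trans
        ((ha.trans ho.symm).trans
          (X.presheaf.germ_res_apply (homOfLE inf_le_right) _ hηSV s).symm)
    let σ : Γ(X, S ⊔ V) := (X.sheaf.objSupIsoProdEqLocus S V).inv ⟨(a, s), hagree⟩
    refine ⟨X.presheaf.map (homOfLE hcov).op σ, ?_⟩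
    have h1 : X.presheaf.map (homOfLE le_sup_left).op σ = a :=
      X.sheaf.objSupIsoProdEqLocus_inv_fst S V ⟨(a, s), hagree⟩
    have h2 := X.presheaf.germ_res_apply (homOfLE hcov) (genericPoint X) trivial σ
    have h3 := X.presheaf.germ_res_apply (homOfLE (le_sup_left : S ≤ S ⊔ V)) (genericPoint X) hη σ
    rw [h1] at h3
    exact h2.trans (h3.symm.trans ha)

end PoonenScheme

theorem mainTheorem10 (Sbar : Scheme.{u}) [AlgebraicGeometry.IsIntegral Sbar]
    (infty : Sbar) (hinfty : IsClosed ({infty} : Set Sbar))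
    (hval : ValuationRing (Sbar.presheaf.stalk infty))
    (S : Sbar.Opens) (hS : (S : Set Sbar) = {infty}ᶜ)
    [Nonempty S] (hS_affine : IsAffineOpen S)
    (hfield : IsField Γ(Sbar, ⊤)) :
    (Sbar.presheaf.germ ⊤ (genericPoint Sbar) trivial).hom.range =
        (Sbar.germToFunctionField S).hom.range ⊓
          (algebraMap (Sbar.presheaf.stalk infty) Sbar.functionField).range ∧
      PoonenScheme.ConditionP2 Γ(Sbar, S) ∧
      PoonenScheme.IsPoonenRing Γ(Sbar, S) ∧
      PoonenScheme.IsPoonenScheme S.toScheme ∧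
      PoonenScheme.IsPoonenScheme Sbar := by
  have hrange := PoonenScheme.range_germ_top infty S hS
  have hη : genericPoint Sbar ∈ S := ((genericPoint_spec Sbar).mem_open_set_iff S.isOpen).2
    (by simpa using ‹Nonempty S›)
  have := functionField_isFractionRing_of_isAffineOpen Sbar S hS_affine
  have hP2 : PoonenScheme.ConditionP2 Γ(Sbar, S) := by
    refine PoonenScheme.ConditionP2.of_valuationRing (O := Sbar.presheaf.stalk infty)
      (K := Sbar.functionField) (fun h => ?_) fun a ha haO => ?_
    · have := PoonenScheme.eq_genericPoint_of_surjective infty h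
      rw [← this, ← SetLike.mem_coe, hS] at hη
      exact hη rfl
    -- An element of `A ∩ O` is a global section, so its inverse is found in the field of global
    -- sections.
    · obtain ⟨s, hs⟩ := hrange.ge ⟨⟨a, rfl⟩, haO⟩
      have hinj := Sbar.germToFunctionField_injective S
      have hs0 : s ≠ 0 := by
        rintro rfl
        rw [map_zero] at hs
        exact ha (hinj (hs.symm.trans (map_zero _).symm))
      obtain ⟨r, hr⟩ := hfield.mul_inv_cancel hs0
      obtain ⟨⟨b, hb⟩, hbO⟩ := hrange.le ⟨r, rfl⟩
      refine ⟨b, hinj ?_, ?_⟩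
      · rw [map_mul, map_one]
        have := congrArg (Sbar.presheaf.germ ⊤ (genericPoint Sbar) trivial).hom hr
        rw [map_mul, map_one, hs, ← hb] at this
        exact this
      · exact hb ▸ hbO
  refine ⟨hrange, hP2, ?_, ?_, ?_⟩
  · exact PoonenScheme.IsPoonenScheme.of_conditionP2 hP2 (𝟙 _)
  · exact PoonenScheme.IsPoonenScheme.of_conditionP2 hP2 hS_affine.isoSpec.inv
  · exact PoonenScheme.IsPoonenScheme.of_conditionP2 hP2 hS_affine.fromSpec
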